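/- **Institutions and diagrams.** An institution consists of a category of signatures, a functor $\mathrm{Sen}$ from signatures to sets (sentences), a contravariant functor $\mathrm{Mod}$ from signatures to categories (models, with reduct functors), and satisfaction relations $\models_\Sigma$ such that $M'\models \varphi(\rho)$ iff $\mathrm{Mod}(\varphi)M'\models\rho$. It *has diagrams* if one can choose, for every signature $\Sigma$ and $\Sigma$-model $M$, a signature morphism $\iota_\Sigma(M):\Sigma\to\Sigma_M$ (the elementary extension) and a set $E_M$ of $\Sigma_M$-sentences (the diagram), together with an isomorphism of categories $i_{\Sigma,M}:\mathrm{Mod}(\Sigma_M,E_M)\to M/\mathrm{Mod}(\Sigma)$ whose composite with the forgetful functor $M/\mathrm{Mod}(\Sigma)\to\mathrm{Mod}(\Sigma)$ is the reduct functor $\mathrm{Mod}(\iota_\Sigma(M))$. Here $\mathrm{Mod}(\Sigma_M,E_M)$ is the full subcategory of models satisfying $E_M$. Moreover $\iota$ is functorial and $i$ is natural in $\Sigma$ and $M$: each signature morphism $\varphi:\Sigma\to\Sigma'$ with a homomorphism $h:M\to\mathrm{Mod}(\varphi)M'$ induces a morphism $\iota_\varphi(h):\Sigma_M\to\Sigma'_{M'}$,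 compatible with identities and composition, with $\iota_\Sigma(M);\iota_\varphi(h)=\varphi;\iota_{\Sigma'}(M')$, such that reducts along it of models of $E_{M'}$ are models of $E_M$, and such that $i$ commutes with the induced functors $\mathrm{Mod}(\Sigma'_{M'},E_{M'})\to\mathrm{Mod}(\Sigma_M,E_M)$ and $M'/\mathrm{Mod}(\Sigma')\to M/\mathrm{Mod}(\Sigma)$. **Hybrid first-order logic HFOL (with equality).** Signatures are triples $(\mathrm{Nom},F,P)$ of a set of nominals and families $F=(F_n)_{n\in\omega}$, $P=(P_n)_{n\in\omega}$ of function and predicate symbols; morphisms are families of functions. Sentences are generated by $$S ::= t=t' \mid \pi(t_1,\dots,t_n)\mid k\mbox{-}\mathsf{sen}\mid S\wedge S\mid\neg S\mid\Diamond S\mid @_kS\mid(\exists k)S'\mid(\exists x)S''$$ with $t,t',t_1,\dots,t_n$ terms over $F$, $\pi\in P_n$, $k\in\mathrm{Nom}$ (in $(\exists k)S'$ and $(\exists x)S''$ the sentence $S'$, resp. $S''$, is over the signature with one new nominal $k$, resp. one new constant $x$). A model $(W,M)$ consists of a set $|W|$ of worlds, a relation $W_\lambda\subseteq|W|\times|W|$,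 an element $W_k\in|W|$ for each $k\in\mathrm{Nom}$, and a first-order $(F,P)$-structure $M^w$ for each $w\in|W|$, where all $M^w$ have the same carrier $|M|$ and the same interpretation of the constants in $F_0$ ($|M|=\emptyset$ when $|W|=\emptyset$). A homomorphism $(W,M)\to(V,N)$ is a pair $(h_0,h_1)$ where $h_0:|W|\to|V|$ preserves the relation and the nominals and $h_1:|M|\to|N|$ is a first-order homomorphism $M^w\to N^{h_0(w)}$ for every $w\in|W|$. Satisfaction $(W,M)\models^w\rho$ at a world is the usual one: atoms are evaluated in $M^w$; $k\mbox{-}\mathsf{sen}$ holds at $w$ iff $W_k=w$; $@_k\rho$ holds at $w$ iff $\rho$ holds at $W_k$; $\Diamond\rho$ holds at $w$ iff $\rho$ holds at some $w'$ with $(w,w')\in W_\lambda$; the connectives are classical; quantifiers range over worlds, resp. over $|M|$. $\mathrm{HFOL}^*$ is the institution with these models and $(W,M)\models^*\rho$ iff $(W,M)\models^w\rho$ for all $w\in|W|$. $\mathrm{HFOL}^\sharp$ has as models the pairs $((W,M),w)$ with $w\in|W|$, as homomorphisms those of HFOL that map the distinguished world to the distinguished world, and $((W,M),w)\models^\sharp\rho$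 iff $(W,M)\models^w\rho$. **Theorem.** $\mathrm{HFOL}^*$ and $\mathrm{HFOL}^\sharp$ have diagrams. More precisely: * $\mathrm{HFOL}^*$ has diagrams in which, for each $(\mathrm{Nom},F,P)$-model $(W,M)$, the elementary extension is the inclusion $(\mathrm{Nom},F,P)\to(\mathrm{Nom}+|W|,F+|M|,P)$ that adds the worlds as nominals and the elements of $|M|$ as constants, and the diagram is $$E_{(W,M)}=\{@_i\Diamond\, j\mbox{-}\mathsf{sen}\mid(i,j)\in W_\lambda\}\cup\{@_k\,w\mbox{-}\mathsf{sen}\mid k\in\mathrm{Nom},\ w=W_k\}\cup\{@_i\rho\mid i\in|W|,\ \rho\in E_{M^i}\},$$ where $E_{M^i}$, the first-order diagram of $M^i$, is the set of all atomic $(F+|M|,P)$-sentences (equations between variable-free terms and relational atoms) that hold in the expansion of $M^i$ interpreting each $a\in|M|$ by itself. * $\mathrm{HFOL}^\sharp$ has diagrams in which, for each model $((W,M),w)$, the elementary extension is that of $(W,M)$ and the diagram is $E_{(W,M)}\cup\{w\mbox{-}\mathsf{sen}\}$. -/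

import Mathlib

set_option linter.checkUnivs false

open CategoryTheory

universe u u₁ v₁ u₂ v₂ w₁ w₂

/-! ## Institutions -/

/-- An institution. The model functor `Signᵒᵖ ⥤ CAT` is given by its values `Mod S`, its action
`reduct` on signature morphisms, and the two functor laws. -/
structure Institution where
  Sign : Type u₁
  [catSign : Category.{v₁} Sign]
  Sen : Sign ⥤ Type w₁
  Mod : Sign → Type u₂
  [catMod : ∀ S, Category.{v₂} (Mod S)]
  reduct : ∀ {S S' : Sign}, (S ⟶ S') → (Mod S' ⥤ Mod S)
  reduct_id : ∀ S : Sign, reduct (𝟙 S) = 𝟭 (Mod S)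
  reduct_comp : ∀ {S S' S'' : Sign} (φ : S ⟶ S') (ψ : S' ⟶ S''),
    reduct (φ ≫ ψ) = reduct ψ ⋙ reduct φ
  Sat : ∀ {S : Sign}, Mod S → Sen.obj S → Prop
  sat_iff : ∀ {S S' : Sign} (φ : S ⟶ S') (M' : Mod S') (ρ : Sen.obj S),
    Sat M' (Sen.map φ ρ) ↔ Sat ((reduct φ).obj M') ρ

attribute [instance] Institution.catSign Institution.catMod

namespace Institution

variable (I : Institution.{u₁, v₁, u₂, v₂, w₁})

/-- The models of a set `E` of sentences; `(I.models E).FullSubcategory` is `Mod(S, E)`. -/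
def models {S : I.Sign} (E : Set (I.Sen.obj S)) : ObjectProperty (I.Mod S) :=
  fun M => ∀ ρ ∈ E, I.Sat M ρ

/-- `M ⟶ φ(φ'(M''))` obtained from `h : M ⟶ φ(M')` and `h' : M' ⟶ φ'(M'')`, seen as a morphism
into the reduct of `M''` along `φ ≫ φ'`. -/
def homComp {S S' S'' : I.Sign} (φ : S ⟶ S') (φ' : S' ⟶ S'')
    {M : I.Mod S} {M' : I.Mod S'} {M'' : I.Mod S''}
    (h : M ⟶ (I.reduct φ).obj M') (h' : M' ⟶ (I.reduct φ').obj M'') :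
    M ⟶ (I.reduct (φ ≫ φ')).obj M'' :=
  h ≫ (I.reduct φ).map h' ≫ eqToHom (by rw [I.reduct_comp]; rfl)

/-- The identity of `M`, seen as a morphism into the reduct of `M` along `𝟙 S`. -/
def homId {S : I.Sign} (M : I.Mod S) : M ⟶ (I.reduct (𝟙 S)).obj M :=
  eqToHom (by rw [I.reduct_id]; rfl)

/-- The functor `M' / Mod S' ⥤ M / Mod S` sending `f : M' ⟶ N'` to `h ≫ φ(f)`. -/
def underReduct {S S' : I.Sign} (φ : S ⟶ S') {M : I.Mod S} {M' : I.Mod S'}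
    (h : M ⟶ (I.reduct φ).obj M') : Under M' ⥤ Under M :=
  Under.post (I.reduct φ) ⋙ Under.map h

/-- The syntactic part of a system of diagrams: for each model `M` of a signature `S`, a
signature `sig M`, the elementary extension `ext M` of `S` via `M`, and a set `diag M` of
sentences over `sig M`. -/
structure DiagramData where
  sig : ∀ {S : I.Sign}, I.Mod S → I.Sign
  ext : ∀ {S : I.Sign} (M : I.Mod S), S ⟶ sig M
  diag : ∀ {S : I.Sign} (M : I.Mod S), Set (I.Sen.obj (sig M))

/-- A system of diagrams of an institution: the elementary extensions are functorial in the
signature and the model, and `Mod(S_M, E_M)` is isomorphic to the comma category `M / Mod S` over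
`Mod S`, naturally in the signature and the model. -/
structure Diagrams extends DiagramData I where
  sigMap : ∀ {S S' : I.Sign} (φ : S ⟶ S') {M : I.Mod S} {M' : I.Mod S'},
    (M ⟶ (I.reduct φ).obj M') → (sig M ⟶ sig M')
  ext_sigMap : ∀ {S S' : I.Sign} (φ : S ⟶ S') {M : I.Mod S} {M' : I.Mod S'}
    (h : M ⟶ (I.reduct φ).obj M'), ext M ≫ sigMap φ h = φ ≫ ext M'
  sigMap_id : ∀ {S : I.Sign} (M : I.Mod S), sigMap (𝟙 S) (I.homId M) = 𝟙 (sig M)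
  sigMap_comp : ∀ {S S' S'' : I.Sign} (φ : S ⟶ S') (φ' : S' ⟶ S'')
    {M : I.Mod S} {M' : I.Mod S'} {M'' : I.Mod S''}
    (h : M ⟶ (I.reduct φ).obj M') (h' : M' ⟶ (I.reduct φ').obj M''),
    sigMap (φ ≫ φ') (I.homComp φ φ' h h') = sigMap φ h ≫ sigMap φ' h'
  diag_sigMap : ∀ {S S' : I.Sign} (φ : S ⟶ S') {M : I.Mod S} {M' : I.Mod S'}
    (h : M ⟶ (I.reduct φ).obj M') (N' : I.Mod (sig M')),
    I.models (diag M') N' → I.models (diag M) ((I.reduct (sigMap φ h)).obj N')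
  iso : ∀ {S : I.Sign} (M : I.Mod S), (I.models (diag M)).FullSubcategory ⥤ Under M
  inv : ∀ {S : I.Sign} (M : I.Mod S), Under M ⥤ (I.models (diag M)).FullSubcategory
  iso_inv : ∀ {S : I.Sign} (M : I.Mod S), iso M ⋙ inv M = 𝟭 _
  inv_iso : ∀ {S : I.Sign} (M : I.Mod S), inv M ⋙ iso M = 𝟭 _
  iso_forget : ∀ {S : I.Sign} (M : I.Mod S),
    iso M ⋙ Under.forget M = (I.models (diag M)).ι ⋙ I.reduct (ext M)
  iso_natural : ∀ {S S' : I.Sign} (φ : S ⟶ S') {M : I.Mod S} {M' : I.Mod S'}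
    (h : M ⟶ (I.reduct φ).obj M'),
    iso M' ⋙ I.underReduct φ h =
      (I.models (diag M)).lift ((I.models (diag M')).ι ⋙ I.reduct (sigMap φ h))
        (fun N' => diag_sigMap φ h N'.obj N'.property) ⋙ iso M

end Institution

/-! ## Stratified institutions -/

/-- A stratified institution. The stratification `⟦_⟧` is a lax natural transformation from the
model functor to the constant functor with value the category of sets. Satisfaction is required
to be preserved by model isomorphisms. -/
structure StratifiedInstitution where
  Sign : Type u₁
  [catSign : Category.{v₁} Sign]
  Sen : Sign ⥤ Type w₁
  Mod : Sign → Type u₂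
  [catMod : ∀ S, Category.{v₂} (Mod S)]
  reduct : ∀ {S S' : Sign}, (S ⟶ S') → (Mod S' ⥤ Mod S)
  reduct_id : ∀ S : Sign, reduct (𝟙 S) = 𝟭 (Mod S)
  reduct_comp : ∀ {S S' S'' : Sign} (φ : S ⟶ S') (ψ : S' ⟶ S''),
    reduct (φ ≫ ψ) = reduct ψ ⋙ reduct φ
  /-- The sets of states `⟦M⟧`. -/
  st : ∀ S : Sign, Mod S ⥤ Type w₂
  stMap : ∀ {S S' : Sign} (φ : S ⟶ S'), st S' ⟶ reduct φ ⋙ st S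
  stMap_id : ∀ {S : Sign} (M : Mod S),
    (stMap (𝟙 S)).app M = (st S).map (eqToHom (by rw [reduct_id]; rfl))
  stMap_comp : ∀ {S S' S'' : Sign} (φ : S ⟶ S') (ψ : S' ⟶ S'') (M : Mod S''),
    (stMap (φ ≫ ψ)).app M =
      (stMap ψ).app M ≫ (stMap φ).app ((reduct ψ).obj M) ≫
        (st S).map (eqToHom (by rw [reduct_comp]; rfl))
  Sat : ∀ {S : Sign} (M : Mod S), (st S).obj M → Sen.obj S → Prop
  sat_iff : ∀ {S S' : Sign} (φ : S ⟶ S') (M' : Mod S') (w : (st S').obj M') (ρ : Sen.obj S),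
    Sat ((reduct φ).obj M') ((stMap φ).app M' w) ρ ↔ Sat M' w (Sen.map φ ρ)
  sat_iso : ∀ {S : Sign} {M N : Mod S} (e : M ≅ N) (w : (st S).obj M) (ρ : Sen.obj S),
    Sat M w ρ ↔ Sat N ((st S).map e.hom w) ρ

attribute [instance] StratifiedInstitution.catSign StratifiedInstitution.catMod

namespace StratifiedInstitution

variable (𝒮 : StratifiedInstitution.{u₁, v₁, u₂, v₂, w₁, w₂})

/-- The stratification is surjective. -/
def IsSurjective : Prop :=
  ∀ {S S' : 𝒮.Sign} (φ : S ⟶ S') (M' : 𝒮.Mod S'),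
    Function.Surjective (fun w : (𝒮.st S').obj M' => (𝒮.stMap φ).app M' w)

/-- The global institution `𝒮*` of a stratified institution with surjective stratification. -/
def global (hs : 𝒮.IsSurjective) : Institution.{u₁, v₁, u₂, v₂, w₁} where
  Sign := 𝒮.Sign
  Sen := 𝒮.Sen
  Mod := 𝒮.Mod
  reduct := 𝒮.reduct
  reduct_id := 𝒮.reduct_id
  reduct_comp := 𝒮.reduct_comp
  Sat M ρ := ∀ w, 𝒮.Sat M w ρ
  sat_iff φ M' ρ := by
    constructor
    · intro h w
      obtain ⟨w', rfl⟩ := hs φ M' w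
      exact (𝒮.sat_iff φ M' w' ρ).2 (h w')
    · intro h w
      exact (𝒮.sat_iff φ M' w ρ).1 (h _)

/-- The reduct functor of the local institution. -/
def localReduct {S S' : 𝒮.Sign} (φ : S ⟶ S') : (𝒮.st S').Elements ⥤ (𝒮.st S).Elements where
  obj p := ⟨(𝒮.reduct φ).obj p.1, (𝒮.stMap φ).app p.1 p.2⟩
  map {p q} f := ⟨(𝒮.reduct φ).map f.1, by
    have h := (𝒮.stMap φ).naturality_apply f.1 p.2
    rw [f.2] at h
    exact h.symm⟩

theorem elements_eqToHom_val {C : Type u₂} [Category.{v₂} C] {F : C ⥤ Type w₂}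
    {x y : F.Elements} (h : x = y) :
    (eqToHom h).1 = eqToHom (congrArg Sigma.fst h) := by
  subst h; rfl

theorem map_eqToHom_cancel {C : Type u₂} [Category.{v₂} C] (F : C ⥤ Type w₂) {X Y : C}
    (h : X = Y) (h' : Y = X) (x : F.obj X) :
    F.map (eqToHom h') (F.map (eqToHom h) x) = x := by
  subst h; simp

/-- The local institution `𝒮♯`: its models are the pairs `(M, w)` with `w ∈ ⟦M⟧`, a homomorphism
`(M, w) ⟶ (N, v)` is a homomorphism `h : M ⟶ N` with `⟦h⟧ w = v`. -/
def localInst : Institution.{u₁, v₁, max u₂ w₂, v₂, w₁} where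
  Sign := 𝒮.Sign
  Sen := 𝒮.Sen
  Mod S := (𝒮.st S).Elements
  reduct := 𝒮.localReduct
  reduct_id S := by
    refine CategoryTheory.Functor.ext (fun p => ?_) (fun p q f => ?_)
    · refine Functor.Elements.ext _ _ (Functor.congr_obj (𝒮.reduct_id S) p.1) ?_
      change (𝒮.st S).map _ ((𝒮.stMap (𝟙 S)).app p.1 p.2) = p.2
      rw [𝒮.stMap_id]
      exact map_eqToHom_cancel _ _ _ _
    · apply Subtype.ext
      rw [CategoryOfElements.comp_val, CategoryOfElements.comp_val, elements_eqToHom_val,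
        elements_eqToHom_val]
      exact Functor.congr_hom (𝒮.reduct_id S) f.1
  reduct_comp {S S' S''} φ ψ := by
    refine CategoryTheory.Functor.ext (fun p => ?_) (fun p q f => ?_)
    · refine Functor.Elements.ext _ _ (Functor.congr_obj (𝒮.reduct_comp φ ψ) p.1) ?_
      change (𝒮.st S).map _ ((𝒮.stMap (φ ≫ ψ)).app p.1 p.2) =
        (𝒮.stMap φ).app _ ((𝒮.stMap ψ).app p.1 p.2)
      rw [𝒮.stMap_comp]
      exact map_eqToHom_cancel _ _ _ _
    · apply Subtype.ext
      rw [CategoryOfElements.comp_val, CategoryOfElements.comp_val, elements_eqToHom_val,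
        elements_eqToHom_val]
      exact Functor.congr_hom (𝒮.reduct_comp φ ψ) f.1
  Sat p ρ := 𝒮.Sat p.1 p.2 ρ
  sat_iff φ p ρ := (𝒮.sat_iff φ p.1 p.2 ρ).symm

end StratifiedInstitution

/-! ## First-order structures and atomic sentences -/

/-- The family of function symbols obtained from `F` by adding the elements of `X` as new
constants. -/
inductive AddConst (F : ℕ → Type u) (X : Type u) : ℕ → Type u
  | old {n : ℕ} (σ : F n) : AddConst F X n
  | new (x : X) : AddConst F X 0

/-- The action on `AddConst` of a translation of symbols and a function on new constants. -/
def AddConst.map {F F' : ℕ → Type u} {X X' : Type u} (φ : ∀ n, F n → F' n) (f : X → X') :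
    ∀ n, AddConst F X n → AddConst F' X' n
  | _, .old σ => .old (φ _ σ)
  | _, .new x => .new (f x)

/-- A single-sorted first-order `(F, P)`-structure with carrier `D`. -/
@[ext]
structure FOLStr (F P : ℕ → Type u) (D : Type u) where
  fn : ∀ n, F n → (Fin n → D) → D
  rel : ∀ n, P n → Set (Fin n → D)

namespace FOLStr

variable {F F' P P' : ℕ → Type u} {D X : Type u}

/-- The reduct of a structure along a translation of symbols. -/
def reduct (φ : ∀ n, F n → F' n) (ψ : ∀ n, P n → P' n) (A : FOLStr F' P' D) : FOLStr F P D where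
  fn n σ := A.fn n (φ n σ)
  rel n π := A.rel n (ψ n π)

/-- The interpretation of function symbols in the expansion of `A` by new constants `x : X`
interpreted as `v x`. -/
def expandFn (A : FOLStr F P D) (v : X → D) : ∀ n, AddConst F X n → (Fin n → D) → D
  | _, .old σ => A.fn _ σ
  | _, .new x => fun _ => v x

/-- The expansion of `A` interpreting the new constants `x : X` as `v x`. -/
def expand (A : FOLStr F P D) (v : X → D) : FOLStr (AddConst F X) P D where
  fn := A.expandFn v
  rel := A.rel

end FOLStr

/-- Variable-free terms formed with function symbols from `F`. -/
inductive Term (F : ℕ → Type u) : Type u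
  | app {n : ℕ} (σ : F n) (ts : Fin n → Term F) : Term F

/-- Translation of terms. -/
def Term.map {F F' : ℕ → Type u} (φ : ∀ n, F n → F' n) : Term F → Term F'
  | .app σ ts => .app (φ _ σ) (fun k => (ts k).map φ)

/-- The value of a term in a structure. -/
def Term.eval {F P : ℕ → Type u} {D : Type u} (A : FOLStr F P D) : Term F → D
  | .app σ ts => A.fn _ σ (fun k => (ts k).eval A)

/-- Atomic first-order `(F, P)`-sentences: equations and relational atoms. -/
inductive Atom (F P : ℕ → Type u) : Type u
  | eq (t t' : Term F) : Atom F P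
  | rel {n : ℕ} (π : P n) (ts : Fin n → Term F) : Atom F P

/-- Translation of atomic sentences. -/
def Atom.map {F F' P P' : ℕ → Type u} (φ : ∀ n, F n → F' n) (ψ : ∀ n, P n → P' n) :
    Atom F P → Atom F' P'
  | .eq t t' => .eq (t.map φ) (t'.map φ)
  | .rel π ts => .rel (ψ _ π) (fun k => (ts k).map φ)

/-- Satisfaction of atomic sentences. -/
def Atom.Holds {F P : ℕ → Type u} {D : Type u} (A : FOLStr F P D) : Atom F P → Prop
  | .eq t t' => t.eval A = t'.eval A
  | .rel π ts => (fun k => (ts k).eval A) ∈ A.rel _ π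

/-- The first-order diagram of a structure: the atomic sentences, in the language with the
elements as new constants, that hold in the expansion interpreting each element by itself. -/
def folDiagram {F P : ℕ → Type u} {D : Type u} (A : FOLStr F P D) :
    Set (Atom (AddConst F D) P) :=
  {a | a.Holds (A.expand id)}

/-! ## Hybrid first-order logic -/

/-- Signatures of hybrid first-order logic: nominals, function symbols, predicate symbols. -/
structure HSig : Type (u + 1) where
  Nom : Type u
  F : ℕ → Type u
  P : ℕ → Type u

/-- Signature morphisms. -/
@[ext]
structure HSigHom (S S' : HSig.{u}) : Type u where
  nom : S.Nom → S'.Nom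
  fn : ∀ n, S.F n → S'.F n
  rel : ∀ n, S.P n → S'.P n

instance : Category HSig.{u} where
  Hom := HSigHom
  id _ := ⟨id, fun _ => id, fun _ => id⟩
  comp φ ψ := ⟨ψ.nom ∘ φ.nom, fun n => ψ.fn n ∘ φ.fn n, fun n => ψ.rel n ∘ φ.rel n⟩

namespace HSig

/-- The signature with the elements of `X` added as new nominals. -/
def addNom (S : HSig.{u}) (X : Type u) : HSig.{u} where
  Nom := S.Nom ⊕ X
  F := S.F
  P := S.P

/-- The signature with the elements of `X` added as new constants. -/
def addConst (S : HSig.{u}) (X : Type u) : HSig.{u} where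
  Nom := S.Nom
  F := AddConst S.F X
  P := S.P

/-- The extension of a signature morphism to signatures with an added nominal variable. -/
def liftNom {S S' : HSig.{u}} (φ : S ⟶ S') : S.addNom PUnit ⟶ S'.addNom PUnit :=
  HSigHom.mk (S := S.addNom PUnit) (S' := S'.addNom PUnit) (Sum.map φ.nom id) φ.fn φ.rel

/-- The extension of a signature morphism to signatures with an added first-order variable. -/
def liftConst {S S' : HSig.{u}} (φ : S ⟶ S') : S.addConst PUnit ⟶ S'.addConst PUnit :=
  HSigHom.mk (S := S.addConst PUnit) (S' := S'.addConst PUnit) φ.nom (AddConst.map φ.fn id) φ.rel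

theorem liftNom_id (S : HSig.{u}) : liftNom (𝟙 S) = 𝟙 (S.addNom PUnit) :=
  HSigHom.ext (Sum.map_id_id) rfl rfl

theorem liftNom_comp {S S' S'' : HSig.{u}} (φ : S ⟶ S') (ψ : S' ⟶ S'') :
    liftNom (φ ≫ ψ) = liftNom φ ≫ liftNom ψ := by
  refine HSigHom.ext ?_ rfl rfl
  funext x
  rcases x with x | x <;> rfl

theorem liftConst_id (S : HSig.{u}) : liftConst (𝟙 S) = 𝟙 (S.addConst PUnit) := by
  refine HSigHom.ext rfl ?_ rfl
  funext n x
  cases x <;> rfl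

theorem liftConst_comp {S S' S'' : HSig.{u}} (φ : S ⟶ S') (ψ : S' ⟶ S'') :
    liftConst (φ ≫ ψ) = liftConst φ ≫ liftConst ψ := by
  refine HSigHom.ext rfl ?_ rfl
  funext n x
  cases x <;> rfl

end HSig

/-- Sentences of hybrid first-order logic. A quantified sentence is formed from a sentence over
the signature with one added nominal, respectively one added constant. -/
inductive HSen : HSig.{u} → Type (u + 1)
  | atom {S : HSig.{u}} (a : Atom S.F S.P) : HSen S
  | nom {S : HSig.{u}} (i : S.Nom) : HSen S
  | and {S : HSig.{u}} (ρ₁ ρ₂ : HSen S) : HSen S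
  | neg {S : HSig.{u}} (ρ : HSen S) : HSen S
  | dia {S : HSig.{u}} (ρ : HSen S) : HSen S
  | sat {S : HSig.{u}} (i : S.Nom) (ρ : HSen S) : HSen S
  | exNom {S : HSig.{u}} (ρ : HSen (S.addNom PUnit)) : HSen S
  | exElem {S : HSig.{u}} (ρ : HSen (S.addConst PUnit)) : HSen S

/-- Translation of sentences. -/
def HSen.map : ∀ {S S' : HSig.{u}}, (S ⟶ S') → HSen S → HSen S'
  | _, _, φ, .atom a => .atom (a.map φ.fn φ.rel)
  | _, _, φ, .nom i => .nom (φ.nom i)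
  | _, _, φ, .and ρ₁ ρ₂ => .and (ρ₁.map φ) (ρ₂.map φ)
  | _, _, φ, .neg ρ => .neg (ρ.map φ)
  | _, _, φ, .dia ρ => .dia (ρ.map φ)
  | _, _, φ, .sat i ρ => .sat (φ.nom i) (ρ.map φ)
  | _, _, φ, .exNom ρ => .exNom (ρ.map (HSig.liftNom φ))
  | _, _, φ, .exElem ρ => .exElem (ρ.map (HSig.liftConst φ))

/-- Kripke structures over a set `W` of worlds and a shared carrier `D`. -/
@[ext]
structure KStr (S : HSig.{u}) (W D : Type u) where
  nom : S.Nom → W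
  acc : W → W → Prop
  base : W → FOLStr S.F S.P D

namespace KStr

variable {S S' : HSig.{u}} {W D X : Type u}

/-- The reduct of a Kripke structure. -/
def reduct (φ : S ⟶ S') (A : KStr S' W D) : KStr S W D where
  nom i := A.nom (φ.nom i)
  acc := A.acc
  base i := (A.base i).reduct φ.fn φ.rel

/-- The expansion of a Kripke structure by new nominals. -/
def expandNom (A : KStr S W D) (v : X → W) : KStr (S.addNom X) W D where
  nom := Sum.elim A.nom v
  acc := A.acc
  base := A.base

/-- The expansion of a Kripke structure by new constants, interpreted alike in all worlds. -/
def expandConst (A : KStr S W D) (v : X → D) : KStr (S.addConst X) W D where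
  nom := A.nom
  acc := A.acc
  base i := (A.base i).expand v

/-- Satisfaction of a sentence at a world. -/
def Sat : ∀ {S : HSig.{u}}, KStr S W D → W → HSen S → Prop
  | _, A, w, .atom a => a.Holds (A.base w)
  | _, A, w, .nom i => A.nom i = w
  | _, A, w, .and ρ₁ ρ₂ => Sat A w ρ₁ ∧ Sat A w ρ₂
  | _, A, w, .neg ρ => ¬ Sat A w ρ
  | _, A, w, .dia ρ => ∃ w', A.acc w w' ∧ Sat A w' ρ
  | _, A, _, .sat i ρ => Sat A (A.nom i) ρ
  | _, A, w, .exNom ρ => ∃ j : W, Sat (A.expandNom (fun _ => j)) w ρ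
  | _, A, w, .exElem ρ => ∃ d : D, Sat (A.expandConst (fun _ => d)) w ρ

end KStr

/-- Models of hybrid first-order logic: a family of first-order structures indexed by worlds,
with a common carrier `D` and a common interpretation of the constants. If there are no worlds,
there is no carrier either, which is expressed by taking `D` empty. -/
structure HModel (S : HSig.{u}) : Type (u + 1) where
  W : Type u
  D : Type u
  str : KStr S W D
  rigid : ∀ (i j : W) (c : S.F 0) (x : Fin 0 → D),
    (str.base i).fn 0 c x = (str.base j).fn 0 c x
  carrier_empty : IsEmpty W → IsEmpty D

/-- Homomorphisms of models: a homomorphism `f₀` between the frames together with a map `f₁` of the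
carriers that is a first-order homomorphism from the structure at each world `i` to the
structure at `f₀ i`. -/
@[ext]
structure HHom {S : HSig.{u}} (M N : HModel S) : Type u where
  f₀ : M.W → N.W
  f₁ : M.D → N.D
  nom : ∀ k, f₀ (M.str.nom k) = N.str.nom k
  acc : ∀ i j, M.str.acc i j → N.str.acc (f₀ i) (f₀ j)
  fn : ∀ i n (σ : S.F n) (x : Fin n → M.D),
    f₁ ((M.str.base i).fn n σ x) = (N.str.base (f₀ i)).fn n σ (f₁ ∘ x)
  rel : ∀ i n (π : S.P n) (x : Fin n → M.D),
    x ∈ (M.str.base i).rel n π → f₁ ∘ x ∈ (N.str.base (f₀ i)).rel n π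

instance (S : HSig.{u}) : Category (HModel S) where
  Hom := HHom
  id M := ⟨id, id, fun _ => rfl, fun _ _ h => h, fun _ _ _ _ => rfl, fun _ _ _ _ h => h⟩
  comp f g := ⟨g.f₀ ∘ f.f₀, g.f₁ ∘ f.f₁,
    fun k => by simp only [Function.comp_apply, f.nom, g.nom],
    fun i j h => g.acc _ _ (f.acc _ _ h),
    fun i n σ x => by simp only [Function.comp_apply, f.fn, g.fn]; rfl,
    fun i n π x h => g.rel _ _ _ _ (f.rel _ _ _ _ h)⟩

/-- The reduct functors. -/
def HModel.reduct {S S' : HSig.{u}} (φ : S ⟶ S') : HModel S' ⥤ HModel S where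
  obj M := ⟨M.W, M.D, M.str.reduct φ, fun i j c x => M.rigid i j (φ.fn 0 c) x, M.carrier_empty⟩
  map f := ⟨f.f₀, f.f₁, fun k => f.nom (φ.nom k), f.acc,
    fun i n σ x => f.fn i n (φ.fn n σ) x, fun i n π x => f.rel i n (φ.rel n π) x⟩

/-- The set of worlds. -/
def HModel.worlds (S : HSig.{u}) : HModel S ⥤ Type u where
  obj M := M.W
  map f := TypeCat.ofHom f.f₀

namespace HFOL

theorem term_map_id {F : ℕ → Type u} (t : Term F) : t.map (fun _ => id) = t := by
  induction t with
  | app σ ts ih => simp only [Term.map, id, ih]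

theorem term_map_comp {F F' F'' : ℕ → Type u} (φ : ∀ n, F n → F' n) (ψ : ∀ n, F' n → F'' n)
    (t : Term F) : t.map (fun n => ψ n ∘ φ n) = (t.map φ).map ψ := by
  induction t with
  | app σ ts ih => simp only [Term.map, Function.comp_apply, ih]

theorem term_eval_map {F F' P P' : ℕ → Type u} {D : Type u} (φ : ∀ n, F n → F' n)
    (ψ : ∀ n, P n → P' n) (A : FOLStr F' P' D) (t : Term F) :
    (t.map φ).eval A = t.eval (A.reduct φ ψ) := by
  induction t with
  | app σ ts ih => simp only [Term.map, Term.eval, ih]; rfl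

theorem holds_map {F F' P P' : ℕ → Type u} {D : Type u} (φ : ∀ n, F n → F' n)
    (ψ : ∀ n, P n → P' n) (A : FOLStr F' P' D) (a : Atom F P) :
    (a.map φ ψ).Holds A ↔ a.Holds (A.reduct φ ψ) := by
  cases a with
  | eq t t' => simp only [Atom.map, Atom.Holds, term_eval_map φ ψ]
  | rel π ts => simp only [Atom.map, Atom.Holds, term_eval_map φ ψ]; rfl

theorem sen_map_id {S : HSig.{u}} (ρ : HSen S) : ρ.map (𝟙 S) = ρ := by
  induction ρ with
  | atom a =>
    cases a with
    | eq t t' => exact congrArg HSen.atom (congrArg₂ Atom.eq (term_map_id t) (term_map_id t'))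
    | rel π ts =>
      exact congrArg HSen.atom (congrArg (Atom.rel π) (funext fun k => term_map_id (ts k)))
  | nom i => rfl
  | and ρ₁ ρ₂ ih₁ ih₂ => simp only [HSen.map, ih₁, ih₂]
  | neg ρ ih => simp only [HSen.map, ih]
  | dia ρ ih => simp only [HSen.map, ih]
  | sat i ρ ih => simp only [HSen.map, ih]; rfl
  | exNom ρ ih => simp only [HSen.map, HSig.liftNom_id, ih]
  | exElem ρ ih => simp only [HSen.map, HSig.liftConst_id, ih]

theorem sen_map_comp {S : HSig.{u}} (ρ : HSen S) : ∀ {S' S'' : HSig.{u}} (φ : S ⟶ S')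
    (ψ : S' ⟶ S''), ρ.map (φ ≫ ψ) = (ρ.map φ).map ψ := by
  induction ρ with
  | atom a =>
    intro S' S'' φ ψ
    cases a with
    | eq t t' =>
      exact congrArg HSen.atom
        (congrArg₂ Atom.eq (term_map_comp φ.fn ψ.fn t) (term_map_comp φ.fn ψ.fn t'))
    | rel π ts =>
      exact congrArg HSen.atom (congrArg (Atom.rel (ψ.rel _ (φ.rel _ π)))
        (funext fun k => term_map_comp φ.fn ψ.fn (ts k)))
  | nom i => intros; rfl
  | and ρ₁ ρ₂ ih₁ ih₂ => intros; simp only [HSen.map, ih₁, ih₂]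
  | neg ρ ih => intros; simp only [HSen.map, ih]
  | dia ρ ih => intros; simp only [HSen.map, ih]
  | sat i ρ ih => intros; simp only [HSen.map, ih]; rfl
  | exNom ρ ih => intros; simp only [HSen.map, HSig.liftNom_comp, ih]
  | exElem ρ ih => intros; simp only [HSen.map, HSig.liftConst_comp, ih]

theorem reduct_expandNom {S S' : HSig.{u}} {W D : Type u} (φ : S ⟶ S') (A : KStr S' W D)
    (j : W) : (A.expandNom (fun _ : PUnit => j)).reduct (HSig.liftNom φ) =
      (A.reduct φ).expandNom (fun _ => j) := by
  refine KStr.ext ?_ rfl rfl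
  funext x
  rcases x with x | x <;> rfl

theorem reduct_expandConst {S S' : HSig.{u}} {W D : Type u} (φ : S ⟶ S') (A : KStr S' W D)
    (d : D) : (A.expandConst (fun _ : PUnit => d)).reduct (HSig.liftConst φ) =
      (A.reduct φ).expandConst (fun _ => d) := by
  refine KStr.ext rfl rfl ?_
  funext i
  refine FOLStr.ext ?_ rfl
  funext n x
  cases x <;> rfl

theorem sat_map {S : HSig.{u}} (ρ : HSen S) : ∀ {S' : HSig.{u}} {W D : Type u} (φ : S ⟶ S')
    (A : KStr S' W D) (w : W), (A.reduct φ).Sat w ρ ↔ A.Sat w (ρ.map φ) := by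
  induction ρ with
  | atom a => intro S' W D φ A w; exact (holds_map φ.fn φ.rel (A.base w) a).symm
  | nom i => intros; rfl
  | and ρ₁ ρ₂ ih₁ ih₂ => intros; simp only [HSen.map, KStr.Sat, ih₁, ih₂]
  | neg ρ ih => intros; simp only [HSen.map, KStr.Sat, ih]
  | dia ρ ih => intros; simp only [HSen.map, KStr.Sat, ih]; rfl
  | sat i ρ ih => intros; simp only [HSen.map, KStr.Sat, ih]; rfl
  | exNom ρ ih => intros; simp only [HSen.map, KStr.Sat, ← ih, reduct_expandNom]
  | exElem ρ ih => intros; simp only [HSen.map, KStr.Sat, ← ih, reduct_expandConst]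

theorem eval_equiv {F P : ℕ → Type u} {D D' : Type u} (e : D ≃ D') (A : FOLStr F P D)
    (B : FOLStr F P D') (hf : ∀ n (σ : F n) (x : Fin n → D), e (A.fn n σ x) = B.fn n σ (e ∘ x))
    (t : Term F) : e (t.eval A) = t.eval B := by
  induction t with
  | app σ ts ih =>
    simp only [Term.eval, hf]
    exact congrArg _ (funext ih)

theorem sat_equiv {S : HSig.{u}} (ρ : HSen S) : ∀ {W W' D D' : Type u} (e₀ : W ≃ W')
    (e₁ : D ≃ D') (A : KStr S W D) (B : KStr S W' D'), (∀ k, e₀ (A.nom k) = B.nom k) →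
    (∀ i j, A.acc i j ↔ B.acc (e₀ i) (e₀ j)) →
    (∀ i n (σ : S.F n) (x : Fin n → D),
      e₁ ((A.base i).fn n σ x) = (B.base (e₀ i)).fn n σ (e₁ ∘ x)) →
    (∀ i n (π : S.P n) (x : Fin n → D),
      x ∈ (A.base i).rel n π ↔ e₁ ∘ x ∈ (B.base (e₀ i)).rel n π) →
    ∀ w, A.Sat w ρ ↔ B.Sat (e₀ w) ρ := by
  induction ρ with
  | atom a =>
    intro W W' D D' e₀ e₁ A B hn ha hf hr w
    have he := fun t => eval_equiv e₁ (A.base w) (B.base (e₀ w)) (hf w) t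
    cases a with
    | eq t t' => simp only [KStr.Sat, Atom.Holds, ← he, e₁.apply_eq_iff_eq]
    | rel π ts =>
      simp only [KStr.Sat, Atom.Holds, hr, ← he]
      rfl
  | nom i =>
    intro W W' D D' e₀ e₁ A B hn ha hf hr w
    simp only [KStr.Sat, ← hn, e₀.apply_eq_iff_eq]
  | and ρ₁ ρ₂ ih₁ ih₂ =>
    intro W W' D D' e₀ e₁ A B hn ha hf hr w
    simp only [KStr.Sat, ih₁ e₀ e₁ A B hn ha hf hr, ih₂ e₀ e₁ A B hn ha hf hr]
  | neg ρ ih =>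
    intro W W' D D' e₀ e₁ A B hn ha hf hr w
    simp only [KStr.Sat, ih e₀ e₁ A B hn ha hf hr]
  | dia ρ ih =>
    intro W W' D D' e₀ e₁ A B hn ha hf hr w
    simp only [KStr.Sat, ih e₀ e₁ A B hn ha hf hr, ha]
    exact e₀.exists_congr_left.trans (by simp)
  | sat i ρ ih =>
    intro W W' D D' e₀ e₁ A B hn ha hf hr w
    simp only [KStr.Sat, ih e₀ e₁ A B hn ha hf hr, hn]
  | exNom ρ ih =>
    intro W W' D D' e₀ e₁ A B hn ha hf hr w
    simp only [KStr.Sat]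
    refine e₀.exists_congr fun j => ?_
    refine ih e₀ e₁ (A.expandNom _) (B.expandNom _) ?_ ha hf hr w
    rintro (k | k)
    · exact hn k
    · rfl
  | exElem ρ ih =>
    intro W W' D D' e₀ e₁ A B hn ha hf hr w
    simp only [KStr.Sat]
    refine e₁.exists_congr fun d => ?_
    refine ih e₀ e₁ (A.expandConst _) (B.expandConst _) hn ha ?_ hr w
    intro i n σ x
    cases σ with
    | old σ => exact hf i n σ x
    | new y => rfl

theorem sat_iso {S : HSig.{u}} {M N : HModel S} (e : M ≅ N) (w : M.W) (ρ : HSen S) :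
    M.str.Sat w ρ ↔ N.str.Sat (e.hom.f₀ w) ρ := by
  have h₀ : ∀ w, e.inv.f₀ (e.hom.f₀ w) = w := fun w =>
    congrFun (congrArg HHom.f₀ e.hom_inv_id) w
  have h₀' : ∀ w, e.hom.f₀ (e.inv.f₀ w) = w := fun w =>
    congrFun (congrArg HHom.f₀ e.inv_hom_id) w
  have h₁ : ∀ d, e.inv.f₁ (e.hom.f₁ d) = d := fun d =>
    congrFun (congrArg HHom.f₁ e.hom_inv_id) d
  have h₁' : ∀ d, e.hom.f₁ (e.inv.f₁ d) = d := fun d =>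
    congrFun (congrArg HHom.f₁ e.inv_hom_id) d
  refine sat_equiv ρ ⟨e.hom.f₀, e.inv.f₀, h₀, h₀'⟩ ⟨e.hom.f₁, e.inv.f₁, h₁, h₁'⟩ M.str N.str
    e.hom.nom (fun i j => ⟨e.hom.acc i j, fun h => ?_⟩) e.hom.fn
    (fun i n π x => ⟨e.hom.rel i n π x, fun h => ?_⟩) w
  · have := e.inv.acc _ _ h
    simpa only [Equiv.coe_fn_mk, h₀] using this
  · have := e.inv.rel _ _ _ _ h
    have hx : e.inv.f₁ ∘ (e.hom.f₁ ∘ x) = x := funext fun k => h₁ (x k)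
    simpa only [Equiv.coe_fn_mk, h₀, hx] using this

/-- Hybrid first-order logic as a stratified institution. -/
def inst : StratifiedInstitution.{u + 1, u, u + 1, u, u + 1, u} where
  Sign := HSig.{u}
  Sen :=
    { obj := HSen
      map := fun φ => TypeCat.ofHom (HSen.map φ)
      map_id := fun S => by ext ρ; exact sen_map_id ρ
      map_comp := fun φ ψ => by ext ρ; exact sen_map_comp ρ φ ψ }
  Mod := HModel
  reduct := HModel.reduct
  reduct_id _ := rfl
  reduct_comp _ _ := rfl
  st := HModel.worlds
  stMap _ := { app := fun _ => 𝟙 _ }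
  stMap_id _ := rfl
  stMap_comp _ _ _ := rfl
  Sat M w ρ := M.str.Sat w ρ
  sat_iff φ M w ρ := sat_map ρ φ M.str w
  sat_iso e w ρ := sat_iso e w ρ

theorem inst_isSurjective : inst.{u}.IsSurjective := fun _ _ w => ⟨w, rfl⟩

/-- The global institution `HFOL*`. -/
def globalInst : Institution.{u + 1, u, u + 1, u, u + 1} := inst.{u}.global inst_isSurjective

/-- The local institution `HFOL♯`. -/
def localInst : Institution.{u + 1, u, u + 1, u, u + 1} := inst.{u}.localInst

/-- The signature `(Nom + |W|, F + |M|, P)` of a model. -/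
def diagSig {S : HSig.{u}} (M : HModel S) : HSig.{u} := (S.addNom M.W).addConst M.D

/-- The inclusion `(Nom, F, P) ⟶ (Nom + |W|, F + |M|, P)`. -/
def diagExt {S : HSig.{u}} (M : HModel S) : S ⟶ diagSig M :=
  HSigHom.mk (S' := diagSig M) Sum.inl (fun _ => AddConst.old) (fun _ => id)

/-- A world of `M`, as a nominal of `diagSig M`. -/
def world {S : HSig.{u}} (M : HModel S) (w : M.W) : (diagSig M).Nom := Sum.inr w

/-- The diagram of a model: the sentences `@_i ◇ j` for `(i, j)` in the accessibility relation, the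
sentences `@_k w` for each nominal `k` of the signature, where `w` is the world denoted by `k`,
and the sentences `@_i ρ` for each world `i` and each `ρ` in the first-order diagram of the
structure at `i`. -/
def diag {S : HSig.{u}} (M : HModel S) : Set (HSen (diagSig M)) :=
  {ρ | ∃ i j : M.W, M.str.acc i j ∧ ρ = .sat (world M i) (.dia (.nom (world M j)))} ∪
  {ρ | ∃ k : S.Nom, ρ = .sat ((diagExt M).nom k) (.nom (world M (M.str.nom k)))} ∪
  {ρ | ∃ i : M.W, ∃ a ∈ folDiagram (M.str.base i), ρ = .sat (world M i) (.atom a)}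

/-- The elementary extensions and the diagrams in `HFOL*`. -/
def globalData : globalInst.{u}.DiagramData where
  sig M := diagSig M
  ext M := diagExt M
  diag M := diag M

/-- The elementary extensions and the diagrams in `HFOL♯`. -/
def localData : localInst.{u}.DiagramData where
  sig p := diagSig p.1
  ext p := diagExt p.1
  diag p := diag p.1 ∪ {HSen.nom (world p.1 p.2)}

end HFOL

/-! The diagram is the method of diagrams relative to worlds. A model `N` of the extended signature
consists of its reduct to the original signature, a world for each `w ∈ |W|` and, since constants
are rigid, one element for each `a ∈ |M|`. This is a pair of maps from `M` into that reduct. The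
sentences `@_i ◇ j` and `@_k w` say that the map on worlds preserves accessibility and nominals. The
atoms `@_i ρ` say that the map on elements is a first-order homomorphism from each `M^i` to the
structure at the image of `i`: it suffices to use the atoms `σ(x) = a` and `π(x)`, and conversely
homomorphisms preserve all atoms. So models of the diagram are the same thing as homomorphisms out
of `M`.

The conversions are `homOfDiag` and `expansion`. One composite is the identity by computation; the
other is `expansion_homOfDiag`, which rests on rigidity (`fn_new`). Naturality is
`isDiagModel_reduct` together with `homOfDiag_reduct`.

Satisfaction enters only through `IsDiagModel`, and the functors are built for any property
equivalent to it. In `HFOL♯` the extra sentence `w-sen` says exactly that the homomorphism preserves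
the distinguished world. -/

namespace HFOL

section

variable {S S' S'' : HSig.{u}} {M : HModel S} {M' : HModel S'} {M'' : HModel S''}

/-! ### Functoriality of elementary extensions. -/

/-- The morphism between elementary extensions induced by a signature morphism and a
homomorphism. -/
def diagMap (φ : S ⟶ S') (h : M ⟶ (HModel.reduct φ).obj M') : diagSig M ⟶ diagSig M' :=
  HSigHom.mk (S := diagSig M) (S' := diagSig M') (Sum.map φ.nom h.f₀) (AddConst.map φ.fn h.f₁)
    φ.rel

/-- The reduct functors obey their laws definitionally, so the `eqToHom`s in `homId` and `homComp`
are identities and plain `𝟙 M` and `≫` may be used here and in `diagMap_comp`. -/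
theorem diagMap_id (M : HModel S) : diagMap (M' := M) (𝟙 S) (𝟙 M) = 𝟙 (diagSig M) := by
  refine HSigHom.ext ?_ ?_ rfl
  · funext x
    rcases x with x | x <;> rfl
  · funext n x
    cases x <;> rfl

theorem diagMap_comp (φ : S ⟶ S') (φ' : S' ⟶ S'') (h : M ⟶ (HModel.reduct φ).obj M')
    (h' : M' ⟶ (HModel.reduct φ').obj M'') :
    diagMap (M' := M'') (φ ≫ φ') (h ≫ (HModel.reduct φ).map h') =
      diagMap φ h ≫ diagMap φ' h' := by
  refine HSigHom.ext ?_ ?_ rfl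
  · funext x
    rcases x with x | x <;> rfl
  · funext n x
    cases x <;> rfl

/-! ### Models of the diagram and homomorphisms out of `M`. -/

/-- The semantic content of the diagram of `M`, for a model `N` of the extended signature. -/
structure IsDiagModel (M : HModel S) (N : HModel (diagSig M)) : Prop where
  acc : ∀ i j, M.str.acc i j → N.str.acc (N.str.nom (world M i)) (N.str.nom (world M j))
  nom : ∀ k, N.str.nom (world M (M.str.nom k)) = N.str.nom ((diagExt M).nom k)
  atom : ∀ i, ∀ a ∈ folDiagram (M.str.base i), a.Holds (N.str.base (N.str.nom (world M i)))

/-- Every sentence of the diagram begins with some `@_i`, so its truth does not depend on the world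
of evaluation `v`. -/
theorem isDiagModel_iff_local (M : HModel S) (N : HModel (diagSig M)) (v : N.W) :
    (∀ ρ ∈ diag M, N.str.Sat v ρ) ↔ IsDiagModel M N := by
  constructor
  · intro h
    refine ⟨fun i j hij => ?_, fun k => h _ (Or.inl (Or.inr ⟨k, rfl⟩)),
      fun i a ha => h _ (Or.inr ⟨i, a, ha, rfl⟩)⟩
    -- The successor provided by `◇` satisfies `j-sen`, hence is the world denoted by `j`.
    obtain ⟨w, hw, e⟩ := h _ (Or.inl (Or.inl ⟨i, j, hij, rfl⟩))
    exact (show N.str.nom (world M j) = w from e) ▸ hw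
  · rintro h ρ ((⟨i, j, hij, rfl⟩ | ⟨k, rfl⟩) | ⟨i, a, ha, rfl⟩)
    · exact ⟨_, h.acc i j hij, rfl⟩
    · exact h.nom k
    · exact h.atom i a ha

theorem isDiagModel_iff_global (M : HModel S) (N : HModel (diagSig M)) :
    (∀ ρ ∈ diag M, ∀ v, N.str.Sat v ρ) ↔ IsDiagModel M N := by
  constructor
  · intro h
    -- Without worlds in `N`, global satisfaction is vacuous. So are the semantic conditions,
    -- because every world of `M` and every nominal of `S` would denote a world of `N`.
    rcases isEmpty_or_nonempty N.W with hN | ⟨⟨v⟩⟩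
    · exact ⟨fun i => isEmptyElim (N.str.nom (world M i)),
        fun k => isEmptyElim (N.str.nom ((diagExt M).nom k)),
        fun i => isEmptyElim (N.str.nom (world M i))⟩
    · exact (isDiagModel_iff_local M N v).1 fun ρ hρ => h ρ hρ v
  · exact fun h ρ hρ v => (isDiagModel_iff_local M N v).2 h ρ hρ

/-- The interpretation of the elements of `M` in a model of the extended signature. -/
noncomputable def elemMap (M : HModel S) (N : HModel (diagSig M)) (d : M.D) : N.D :=
  -- A constant has a value only at a world. The element `d` forces `M` to have a world, by the
  -- convention on empty carriers, and its nominal denotes a world of `N`.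
  (N.str.base (N.str.nom (world M (Classical.choice
    (not_isEmpty_iff.1 fun h => (M.carrier_empty h).false d))))).fn 0 (.new d) Fin.elim0

/-- Rigidity of constants makes the world chosen in `elemMap` irrelevant. -/
theorem fn_new (N : HModel (diagSig M)) (i : N.W) (d : M.D) (x : Fin 0 → N.D) :
    (N.str.base i).fn 0 (.new d) x = elemMap M N d := by
  rw [Subsingleton.elim x Fin.elim0]
  exact N.rigid _ _ _ _

/-- The constant denoting an element, as a term. -/
def elemTerm {F : ℕ → Type u} {D : Type u} (d : D) : Term (AddConst F D) :=
  .app (.new d) Fin.elim0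

/-- The homomorphism from `M` determined by a model of its diagram. -/
noncomputable def homOfDiag (N : HModel (diagSig M)) (hN : IsDiagModel M N) :
    M ⟶ (HModel.reduct (diagExt M)).obj N :=
  HHom.mk (N := (HModel.reduct (diagExt M)).obj N) (fun w => N.str.nom (world M w)) (elemMap M N)
    hN.nom hN.acc
    (fun i n σ x => by
      -- The equation `σ(x) = a`, with `a` the value of `σ` at `x` in `M^i`, belongs to the diagram
      -- by evaluation; read in `N`, it is the homomorphism condition.
      have h := hN.atom i (.eq (.app (.old σ) fun k => elemTerm (x k))
        (elemTerm ((M.str.base i).fn n σ x))) rfl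
      exact (fn_new N _ _ _).symm.trans (h.symm.trans
        (congrArg ((N.str.base _).fn n (.old σ)) (funext fun k => fn_new N _ _ _))))
    (fun i n π x hx => by
      have h := hN.atom i (.rel π fun k => elemTerm (x k)) hx
      exact (congrArg (· ∈ (N.str.base _).rel n π) (funext fun k => fn_new N _ _ _)).mp h)

/-- The expansion of the codomain of a homomorphism from `M` by the images of the worlds and the
elements of `M`. -/
def expansion {N : HModel S} (f : M ⟶ N) : HModel (diagSig M) where
  W := N.W
  D := N.D
  str := (N.str.expandNom f.f₀).expandConst f.f₁
  rigid i j c x := by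
    cases c with
    | old c => exact N.rigid i j c x
    | new d => rfl
  carrier_empty := N.carrier_empty

/-- `f₁` remains a homomorphism after the expansions, since the constant `d` denotes `d` on the left
and `f₁ d` on the right; homomorphisms commute with evaluation of terms. -/
theorem eval_expand {N : HModel S} (f : M ⟶ N) (i : M.W) (t : Term (AddConst S.F M.D)) :
    t.eval ((N.str.base (f.f₀ i)).expand f.f₁) =
      f.f₁ (t.eval ((M.str.base i).expand id)) := by
  induction t with
  | app σ ts ih =>
    simp only [Term.eval, ih]
    cases σ with
    | old σ => exact (f.fn i _ σ _).symm
    | new d => rfl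

theorem expansion_isDiagModel {N : HModel S} (f : M ⟶ N) : IsDiagModel M (expansion f) where
  acc := f.acc
  nom := f.nom
  atom i a ha := by
    change a.Holds ((N.str.base (f.f₀ i)).expand f.f₁)
    cases a with
    | eq t t' =>
      simp only [Atom.Holds, eval_expand f i]
      exact congrArg f.f₁ ha
    | rel π ts =>
      simp only [Atom.Holds, eval_expand f i]
      exact f.rel i _ π _ ha

theorem reduct_expand (φ : S ⟶ S') (f : M.D → M'.D) (A : FOLStr S'.F S'.P M'.D) :
    (A.expand id).reduct (AddConst.map φ.fn f) φ.rel = (A.reduct φ.fn φ.rel).expand f := by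
  refine FOLStr.ext ?_ rfl
  funext n σ
  cases σ <;> rfl

theorem isDiagModel_reduct (φ : S ⟶ S') (h : M ⟶ (HModel.reduct φ).obj M')
    (N' : HModel (diagSig M')) (hN' : IsDiagModel M' N') :
    IsDiagModel M ((HModel.reduct (diagMap φ h)).obj N') where
  acc i j hij := hN'.acc _ _ (h.acc i j hij)
  nom k := (congrArg (fun w => N'.str.nom (world M' w)) (h.nom k)).trans (hN'.nom (φ.nom k))
  atom i a ha := by
    -- The translated atom must lie in the diagram of the structure of `M'` at `h.f₀ i`. The
    -- self-expansion of that structure reduces to the expansion of the reduct by `h.f₁`, where `a`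
    -- holds because `h` is a homomorphism.
    refine (holds_map (AddConst.map φ.fn h.f₁) φ.rel _ a).1 (hN'.atom (h.f₀ i) _ ?_)
    refine (holds_map _ _ _ a).2 ?_
    exact (congrArg (fun B => Atom.Holds B a) (reduct_expand φ h.f₁ _)).mpr
      ((expansion_isDiagModel h).atom i a ha)

theorem elemMap_natural {N N' : HModel (diagSig M)} (g : N ⟶ N') (d : M.D) :
    g.f₁ (elemMap M N d) = elemMap M N' d :=
  (g.fn _ 0 _ _).trans (fn_new _ _ _ _)

/-- A homomorphism over the extended signature preserves the new nominals and constants, which is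
what the commuting triangle under `M` asserts. -/
theorem homOfDiag_natural {N N' : HModel (diagSig M)} (hN : IsDiagModel M N)
    (hN' : IsDiagModel M N') (g : N ⟶ N') :
    homOfDiag N hN ≫ (HModel.reduct (diagExt M)).map g = homOfDiag N' hN' :=
  HHom.ext (funext fun w => g.nom (world M w)) (funext fun d => elemMap_natural g d)

theorem elemMap_reduct (φ : S ⟶ S') (h : M ⟶ (HModel.reduct φ).obj M')
    (N' : HModel (diagSig M')) (d : M.D) :
    elemMap M ((HModel.reduct (diagMap φ h)).obj N') d = elemMap M' N' (h.f₁ d) :=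
  fn_new (M := M') N' _ _ _

theorem homOfDiag_reduct (φ : S ⟶ S') (h : M ⟶ (HModel.reduct φ).obj M')
    (N' : HModel (diagSig M')) (hN' : IsDiagModel M' N') :
    homOfDiag _ (isDiagModel_reduct φ h N' hN') =
      h ≫ (HModel.reduct φ).map (homOfDiag N' hN') :=
  HHom.ext rfl (funext fun d => elemMap_reduct φ h N' d)

/-- The action of `expansion` on morphisms under `M`. -/
def expansionMap {N N' : HModel S} {f : M ⟶ N} {f' : M ⟶ N'} (g : N ⟶ N') (w : f ≫ g = f') :
    expansion f ⟶ expansion f' :=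
  HHom.mk (M := expansion f) (N := expansion f') g.f₀ g.f₁
    (fun k => by
      -- With `f'` replaced by `f ≫ g`, preservation of the added symbols holds by definition.
      subst w
      rcases k with k | k
      · exact g.nom k
      · rfl)
    g.acc
    (fun i n σ x => by
      subst w
      cases σ with
      | old σ => exact g.fn i _ σ x
      | new d => rfl)
    g.rel

/-- An isomorphism of categories, not merely an equivalence, requires equality of models. Worlds and
carrier agree definitionally; only the new constants need an argument, namely `fn_new`. -/
theorem expansion_homOfDiag (N : HModel (diagSig M)) (hN : IsDiagModel M N) :
    expansion (homOfDiag N hN) = N := by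
  have h : (expansion (homOfDiag N hN)).str = N.str := by
    refine KStr.ext ?_ rfl ?_
    · funext k
      rcases k with k | k <;> rfl
    · funext i
      refine FOLStr.ext ?_ rfl
      funext n σ x
      cases σ with
      | old σ => rfl
      | new d => exact (fn_new N i d x).symm
  obtain ⟨W, D, A, hr, he⟩ := N
  simp only [expansion] at h ⊢
  congr 1

/-! ### Equality of morphisms and functors up to `eqToHom`. -/

theorem comp_f₀ {N₁ N₂ N₃ : HModel S} (f : N₁ ⟶ N₂) (g : N₂ ⟶ N₃) :
    HHom.f₀ (f ≫ g) = HHom.f₀ g ∘ HHom.f₀ f := rfl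

theorem comp_f₁ {N₁ N₂ N₃ : HModel S} (f : N₁ ⟶ N₂) (g : N₂ ⟶ N₃) :
    HHom.f₁ (f ≫ g) = HHom.f₁ g ∘ HHom.f₁ f := rfl

theorem eqToHom_f₀ {N N' : HModel S} (h : N = N') :
    HHom.f₀ (eqToHom h) = cast (by rw [h]) (id : N.W → N.W) := by
  subst h; rfl

theorem eqToHom_f₁ {N N' : HModel S} (h : N = N') :
    HHom.f₁ (eqToHom h) = cast (by rw [h]) (id : N.D → N.D) := by
  subst h; rfl

/-- The equality of models changes neither worlds nor carrier, so both transports are casts along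
reflexive equalities and compute to identities. -/
theorem expansionMap_homOfDiag {N N' : HModel (diagSig M)} (hN : IsDiagModel M N)
    (hN' : IsDiagModel M N') (g : N ⟶ N') :
    expansionMap ((HModel.reduct (diagExt M)).map g) (homOfDiag_natural hN hN' g) =
      eqToHom (expansion_homOfDiag N hN) ≫ g ≫ eqToHom (expansion_homOfDiag N' hN').symm := by
  refine HHom.ext ?_ ?_
  · rw [comp_f₀, comp_f₀, eqToHom_f₀, eqToHom_f₀]
    rfl
  · rw [comp_f₁, comp_f₁, eqToHom_f₁, eqToHom_f₁]
    rfl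

end

end HFOL

/-- Reduces equality of functors into full subcategories, `Under` or element categories to equality
after forgetting, leaving only equality on objects to be checked upstairs. -/
theorem CategoryTheory.Functor.ext_of_comp_faithful {C : Type u₁} [Category.{v₁} C] {D : Type u₂}
    [Category.{v₂} D] {E : Type w₁} [Category.{w₂} E] (K : D ⥤ E) [K.Faithful] {F G : C ⥤ D}
    (hobj : ∀ X, F.obj X = G.obj X) (h : F ⋙ K = G ⋙ K) : F = G :=
  Functor.ext hobj fun X Y f => K.map_injective (by
    rw [K.map_comp, K.map_comp, eqToHom_map, eqToHom_map]
    exact Functor.congr_hom h f)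

/-! ### The isomorphism of categories for `HFOL*`. -/

namespace HFOL

section

variable {S S' : HSig.{u}} {M : HModel S} {M' : HModel S'}
  {P : ObjectProperty (HModel (diagSig M))} (hP : ∀ N, P N ↔ IsDiagModel M N)
  {P' : ObjectProperty (HModel (diagSig M'))} (hP' : ∀ N, P' N ↔ IsDiagModel M' N)

/-- The functor from the models of the diagram of `M` to the homomorphisms with domain `M`. -/
noncomputable def diagIso : P.FullSubcategory ⥤ Under M where
  obj N := Under.mk (homOfDiag N.obj ((hP _).1 N.property))
  map {N N'} g := Under.homMk ((HModel.reduct (diagExt M)).map g.hom)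
    (homOfDiag_natural ((hP _).1 N.property) ((hP _).1 N'.property) g.hom)

/-- The functor from the homomorphisms with domain `M` to the models of the diagram of `M`. -/
def diagInv : Under M ⥤ P.FullSubcategory where
  obj f := ⟨expansion f.hom, (hP _).2 (expansion_isDiagModel f.hom)⟩
  map g := ObjectProperty.homMk (expansionMap g.right (Under.w g))

theorem diagIso_diagInv : diagIso hP ⋙ diagInv hP = 𝟭 P.FullSubcategory := by
  refine Functor.ext_of_comp_faithful P.ι (fun N => ?_) ?_
  · exact ObjectProperty.FullSubcategory.ext (expansion_homOfDiag N.obj ((hP _).1 N.property))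
  · refine CategoryTheory.Functor.ext (fun N => ?_) (fun N N' g => ?_)
    · exact expansion_homOfDiag N.obj ((hP _).1 N.property)
    · exact expansionMap_homOfDiag ((hP _).1 N.property) ((hP _).1 N'.property) g.hom

theorem diagIso_natural (φ : S ⟶ S') (h : M ⟶ (HModel.reduct φ).obj M') :
    diagIso hP' ⋙ Under.post (HModel.reduct φ) ⋙ Under.map h =
      P.lift (P'.ι ⋙ HModel.reduct (diagMap φ h))
        (fun N' => (hP _).2 (isDiagModel_reduct φ h N'.obj ((hP' _).1 N'.property))) ⋙
        diagIso hP :=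
  Functor.ext_of_comp_faithful (Under.forget M)
    (fun N' => congrArg (Under.mk (Y := (HModel.reduct φ).obj
        ((HModel.reduct (diagExt M')).obj N'.obj)))
      (homOfDiag_reduct φ h N'.obj ((hP' _).1 N'.property)).symm) rfl

end

/-- The diagrams of `HFOL*`. -/
noncomputable def globalDiagrams : globalInst.{u}.Diagrams where
  toDiagramData := globalData
  sigMap φ _ _ h := diagMap φ h
  ext_sigMap _ _ _ _ := rfl
  sigMap_id M := diagMap_id M
  sigMap_comp φ φ' _ _ _ h h' := diagMap_comp φ φ' h h'
  diag_sigMap φ _ _ h N' hN' := (isDiagModel_iff_global _ _).2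
    (isDiagModel_reduct φ h N' ((isDiagModel_iff_global _ _).1 hN'))
  iso M := diagIso (isDiagModel_iff_global M)
  inv M := diagInv (isDiagModel_iff_global M)
  iso_inv M := diagIso_diagInv (isDiagModel_iff_global M)
  -- Reducing an expansion returns the codomain, and its new symbols denote the images under `f`, so
  -- `f` is recovered by computation.
  inv_iso _ := rfl
  iso_forget _ := rfl
  iso_natural {_ _} φ {M M'} h :=
    diagIso_natural (isDiagModel_iff_global M) (isDiagModel_iff_global M') φ h

/-! ### Models with a distinguished world and `HFOL♯`. -/

section

variable {S S' : HSig.{u}} {p : (HModel.worlds S).Elements} {p' : (HModel.worlds S').Elements}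

/-- The reduct functors between models with a distinguished world. -/
abbrev pointedReduct (φ : S ⟶ S') : (HModel.worlds S').Elements ⥤ (HModel.worlds S).Elements :=
  inst.{u}.localReduct φ

/-- The semantic content of the diagram of a model with a distinguished world. -/
def IsPointedDiagModel (p : (HModel.worlds S).Elements)
    (q : (HModel.worlds (diagSig p.1)).Elements) : Prop :=
  IsDiagModel p.1 q.1 ∧ q.1.str.nom (world p.1 p.2) = q.2

/-- The distinguished world serves as the world of evaluation, so no case of empty frames arises,
and `w-sen` becomes the condition on `q.2`. -/
theorem isPointedDiagModel_iff (p : (HModel.worlds S).Elements)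
    (q : (HModel.worlds (diagSig p.1)).Elements) :
    (∀ ρ ∈ diag p.1 ∪ {HSen.nom (world p.1 p.2)}, q.1.str.Sat q.2 ρ) ↔
      IsPointedDiagModel p q := by
  constructor
  · exact fun h => ⟨(isDiagModel_iff_local p.1 q.1 q.2).1 fun ρ hρ => h ρ (Or.inl hρ),
      h _ (Or.inr rfl)⟩
  · rintro ⟨h, e⟩ ρ (hρ | rfl)
    · exact (isDiagModel_iff_local p.1 q.1 q.2).2 h ρ hρ
    · exact e

theorem isPointedDiagModel_reduct (φ : S ⟶ S') (h : p ⟶ (pointedReduct φ).obj p')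
    (q' : (HModel.worlds (diagSig p'.1)).Elements) (hq' : IsPointedDiagModel p' q') :
    IsPointedDiagModel p ((pointedReduct (diagMap φ h.1)).obj q') :=
  ⟨isDiagModel_reduct φ h.1 q'.1 hq'.1,
    (congrArg (fun w => q'.1.str.nom (world p'.1 w)) h.2).trans hq'.2⟩

variable {P : ObjectProperty (HModel.worlds (diagSig p.1)).Elements}
  (hP : ∀ q, P q ↔ IsPointedDiagModel p q)
  {P' : ObjectProperty (HModel.worlds (diagSig p'.1)).Elements}
  (hP' : ∀ q, P' q ↔ IsPointedDiagModel p' q)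

/-- The functor from the models of the diagram of `p` to the homomorphisms with domain `p`. -/
noncomputable def pointedDiagIso : P.FullSubcategory ⥤ Under p where
  obj q := Under.mk (Y := (pointedReduct (diagExt p.1)).obj q.obj)
    -- The second component is the truth of `w-sen`: the distinguished world of `p` is sent to that
    -- of `q`.
    ⟨homOfDiag q.obj.1 ((hP _).1 q.property).1, ((hP _).1 q.property).2⟩
  map {q q'} g := Under.homMk ((pointedReduct (diagExt p.1)).map g.hom)
    (Subtype.ext (homOfDiag_natural ((hP _).1 q.property).1 ((hP _).1 q'.property).1 g.hom.1))

/-- The functor from the homomorphisms with domain `p` to the models of the diagram of `p`. -/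
def pointedDiagInv : Under p ⥤ P.FullSubcategory where
  obj f := ⟨⟨expansion f.hom.1, f.right.2⟩, (hP _).2 ⟨expansion_isDiagModel f.hom.1, f.hom.2⟩⟩
  map g := ObjectProperty.homMk
    ⟨expansionMap g.right.1 (congrArg Subtype.val (Under.w g)), g.right.2⟩

theorem pointed_expansion_homOfDiag (q : (HModel.worlds (diagSig p.1)).Elements)
    (hq : IsPointedDiagModel p q) :
    (⟨expansion (homOfDiag q.1 hq.1), q.2⟩ : (HModel.worlds (diagSig p.1)).Elements) = q := by
  refine Functor.Elements.ext _ _ (expansion_homOfDiag q.1 hq.1) ?_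
  change HHom.f₀ (eqToHom (expansion_homOfDiag q.1 hq.1)) q.2 = q.2
  rw [eqToHom_f₀]
  rfl

theorem pointedDiagIso_inv : pointedDiagIso hP ⋙ pointedDiagInv hP = 𝟭 P.FullSubcategory := by
  -- Two faithful functors are applied in turn, forgetting the diagram and then the distinguished
  -- world, which leads back to the equations for unpointed models.
  refine Functor.ext_of_comp_faithful P.ι (fun q => ?_)
    (Functor.ext_of_comp_faithful (CategoryOfElements.π _) (fun q => ?_) ?_)
  · exact ObjectProperty.FullSubcategory.ext
      (pointed_expansion_homOfDiag q.obj ((hP _).1 q.property))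
  · exact pointed_expansion_homOfDiag q.obj ((hP _).1 q.property)
  · refine CategoryTheory.Functor.ext (fun q => ?_) (fun q q' g => ?_)
    · exact expansion_homOfDiag q.obj.1 ((hP _).1 q.property).1
    · exact expansionMap_homOfDiag ((hP _).1 q.property).1 ((hP _).1 q'.property).1 g.hom.1

theorem pointedDiagIso_natural (φ : S ⟶ S') (h : p ⟶ (pointedReduct φ).obj p') :
    pointedDiagIso hP' ⋙ Under.post (pointedReduct φ) ⋙ Under.map h =
      P.lift (P'.ι ⋙ pointedReduct (diagMap φ h.1))
        (fun q' => (hP _).2 (isPointedDiagModel_reduct φ h q'.obj ((hP' _).1 q'.property))) ⋙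
        pointedDiagIso hP :=
  Functor.ext_of_comp_faithful (Under.forget p)
    (fun q' => congrArg (Under.mk (Y := (pointedReduct φ).obj
        ((pointedReduct (diagExt p'.1)).obj q'.obj)))
      (Subtype.ext (homOfDiag_reduct φ h.1 q'.obj.1 ((hP' _).1 q'.property).1)).symm) rfl

end

/-- The diagrams of `HFOL♯`. -/
noncomputable def localDiagrams : localInst.{u}.Diagrams where
  toDiagramData := localData
  sigMap φ _ _ h := diagMap φ h.1
  ext_sigMap _ _ _ _ := rfl
  sigMap_id p := diagMap_id p.1
  sigMap_comp φ φ' _ _ _ h h' := diagMap_comp φ φ' h.1 h'.1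
  diag_sigMap φ _ _ h q' hq' := (isPointedDiagModel_iff _ _).2
    (isPointedDiagModel_reduct φ h q' ((isPointedDiagModel_iff _ _).1 hq'))
  iso p := pointedDiagIso (isPointedDiagModel_iff p)
  inv p := pointedDiagInv (isPointedDiagModel_iff p)
  iso_inv p := pointedDiagIso_inv (isPointedDiagModel_iff p)
  inv_iso _ := rfl
  iso_forget _ := rfl
  iso_natural {_ _} φ {p p'} h :=
    pointedDiagIso_natural (isPointedDiagModel_iff p) (isPointedDiagModel_iff p') φ h

end HFOL

theorem mainTheorem5 :
    (∃ 𝒟 : HFOL.globalInst.{u}.Diagrams, 𝒟.toDiagramData = HFOL.globalData) ∧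
    (∃ 𝒟 : HFOL.localInst.{u}.Diagrams, 𝒟.toDiagramData = HFOL.localData) :=
  ⟨⟨HFOL.globalDiagrams, rfl⟩, ⟨HFOL.localDiagrams, rfl⟩⟩
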